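/- Fix an integer $n\ge 5$. A deterministic mechanism $F$ for $2$-Facility Location on the line with $n$ agents maps every profile $x=(x_1,\dots,x_n)\in\mathbb R^n$ of reported locations to a pair of facility locations $F(x)=(F_1(x),F_2(x))\in\mathbb R^2$ with $F_1(x)\le F_2(x)$. For $a\in\mathbb R$ and $y\in\mathbb R^2$ put $\mathrm{cost}(a,y)=\min\{|a-y_1|,|a-y_2|\}$. The mechanism $F$ is - *anonymous* if $F(x)=F(x_{\pi(1)},\dots,x_{\pi(n)})$ for all $x$ and all permutations $\pi$ of the agents; - *strategyproof* if $\mathrm{cost}(x_i,F(x))\le \mathrm{cost}(x_i,F(x_{-i},y))$ for all $x$, all agents $i$ and all $y\in\mathbb R$, where $(x_{-i},y)$ is $x$ with $x_i$ replaced by $y$; - *of bounded approximation ratio* if there is a constant $\rho\ge 1$ (which may depend on $n$ and $F$ but not on $x$) such that $\sum_{i=1}^n \mathrm{cost}(x_i,F(x))\le\rho\cdot\inf_{y\in\mathbb R^2}\sum_{i=1}^n\mathrm{cost}(x_i,y)$ for all $x$. Let $F$ be an anonymous deterministic mechanism for $2$-Facility Location on the line with $n\ge 5$ agents. Then $F$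 is strategyproof and has a bounded approximation ratio if and only if $F$ is the Two-Extremes mechanism, up to the position of the redundant facility when all agents are at the same location; that is, if and only if 1. $F(x)=(\min x,\max x)$ for every profile $x$ in which at least two agents have different locations, and 2. for every $c\in\mathbb R$, at least one of the two facilities of $F(c,\dots,c)$ is at $c$. -/

import Mathlib

namespace FacilityLocation

noncomputable section

/-- A deterministic mechanism for `K`-Facility Location on the real line with `n` agents: it maps
every profile of reported locations to a `K`-tuple of facility locations in non-decreasing order. -/
structure Mechanism (K n : ℕ) where
  toFun : (Fin n → ℝ) → (Fin K → ℝ)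
  monotone_toFun : ∀ x, Monotone (toFun x)

instance (K n : ℕ) : CoeFun (Mechanism K n) (fun _ => (Fin n → ℝ) → (Fin K → ℝ)) :=
  ⟨Mechanism.toFun⟩

/-- The cost of an agent at `a` when the facilities are at `y`: the distance from `a` to the nearest
facility (the infimum is over a finite index set, so it is a minimum when `K ≥ 1`). -/
def agentCost {K : ℕ} (a : ℝ) (y : Fin K → ℝ) : ℝ := ⨅ l, |a - y l|

/-- The total connection cost of the agents at `x` when the facilities are at `y`. -/
def socialCost {K n : ℕ} (x : Fin n → ℝ) (y : Fin K → ℝ) : ℝ := ∑ i, agentCost (x i) y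

/-- The optimal cost for the instance `x`, over all placements of `K` facilities. -/
def optCost (K : ℕ) {n : ℕ} (x : Fin n → ℝ) : ℝ := ⨅ y : Fin K → ℝ, socialCost x y

namespace Mechanism

variable {K n : ℕ}

/-- The outcome does not depend on the identities of the agents. -/
def IsAnonymous (F : Mechanism K n) : Prop :=
  ∀ (x : Fin n → ℝ) (p : Equiv.Perm (Fin n)), F x = F (x ∘ p)

/-- No agent can decrease her cost by misreporting her location. -/
def IsStrategyproof (F : Mechanism K n) : Prop :=
  ∀ (x : Fin n → ℝ) (i : Fin n) (y : ℝ),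
    agentCost (x i) (F x) ≤ agentCost (x i) (F (Function.update x i y))

/-- The cost of the outcome is at most `ρ` times the optimal cost, for every instance. -/
def HasApproxRatio (F : Mechanism K n) (ρ : ℝ) : Prop :=
  1 ≤ ρ ∧ ∀ x : Fin n → ℝ, socialCost x (F x) ≤ ρ * optCost K x

/-- The approximation ratio is bounded by a number that does not depend on the instance
(`K` and `n` are fixed, so the bound may depend on them). -/
def HasBoundedApproxRatio (F : Mechanism K n) : Prop :=
  ∃ ρ : ℝ, F.HasApproxRatio ρ

end Mechanism

end

end FacilityLocation

/-!
That the Two-Extremes mechanism is strategyproof is clear, because an agent can only push the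
extremes outwards; its approximation ratio is at most `n`, because of the leftmost agent, the
rightmost agent and any third agent two must share a facility (`min_sub_le_socialCost`).

For the converse, an anonymous mechanism is regarded as a function of the multiset of reports
(`NiceRule`), a notion that is symmetric under reflection of the line. It has to be shown that the
rightmost report obtains a facility (`NiceRule.places_max`). Strategyproofness extends to groups of
agents at a common location. Hence, when the other reports are fixed, the points at which a group
can obtain a facility form a closed set, and in a gap of this set the group is served by the nearer
endpoint. A bounded approximation ratio makes the mechanism optimal on profiles with two locations,
and forces it to keep a facility near an isolated group.

The main tool concerns two groups at `j < k` to the right of everybody else. If the group at `k` is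
not served, then there is a gap, called a hole, that starts at some point of `[j, k)`. Starting
points of holes are dense to the right of the first one, and when the starting point moves slightly
to the right, the midpoint of the hole can move to the right only if, for suitable `k`, one facility
is near `j` and the other one to the right of `k`. As the midpoint lies to the right of the starting
point, this happens arbitrarily far to the right (`RightPair.exists_hole_mid_lt`,
`RightPair.exists_places_near`). Therefore, if one facility always stays to the left of both groups,
the group at `k` is served (`places_right_of_forall_le`).

For three locations this shows that the leftmost group is always served if and only if the rightmost
one is. Agents may then be moved from one extreme to the other, which reduces the case of a single
agent in the middle to two agents on the right (`maxServed_one_two`), and a larger group in the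
middle is handled by splitting it (`MaxServed.of_split`). Profiles with more locations follow by
induction on the number of locations.
-/

namespace FacilityLocation

/-! ### Anonymous rules and group strategyproofness -/

/-- An anonymous strategyproof mechanism for two facilities and `n` agents with a bounded
approximation ratio, as a pair of functions of the multiset of reported locations. The values on
multisets whose size is not `n` are irrelevant, and the two facilities are not ordered, which makes
the notion symmetric under reflection of the line. -/
structure NiceRule (n : ℕ) where
  fst : Multiset ℝ → ℝ
  snd : Multiset ℝ → ℝ
  ratio : ℝ
  strategyproof' : ∀ (a b : ℝ) (s : Multiset ℝ), 1 + s.card = n →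
    min |a - fst (a ::ₘ s)| |a - snd (a ::ₘ s)| ≤ min |a - fst (b ::ₘ s)| |a - snd (b ::ₘ s)|
  approx' : ∀ s : Multiset ℝ, s.card = n → ∀ a ∈ s, ∀ y z : ℝ,
    min |a - fst s| |a - snd s| ≤ ratio * (s.map fun x => min |x - y| |x - z|).sum
  one_le_ratio : 1 ≤ ratio

namespace NiceRule

open Multiset

variable {n : ℕ} (M : NiceRule n)

/-- The distance from `a` to the nearest facility when the reports are `s`. -/
def cost (a : ℝ) (s : Multiset ℝ) : ℝ := min |a - M.fst s| |a - M.snd s|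

/-- One of the two facilities is at `a` when the reports are `s`. -/
def Places (a : ℝ) (s : Multiset ℝ) : Prop := a = M.fst s ∨ a = M.snd s

/-- The mechanism seen in the mirror. -/
def reflect : NiceRule n where
  fst s := -M.fst (s.map Neg.neg)
  snd s := -M.snd (s.map Neg.neg)
  ratio := M.ratio
  strategyproof' a b s hs := by
    have := M.strategyproof' (-a) (-b) (s.map Neg.neg) (by simpa using hs)
    simp only [map_cons]
    rw [← abs_neg (a - _), ← abs_neg (a - -M.snd _), ← abs_neg (a - -M.fst (-b ::ₘ _)),
      ← abs_neg (a - -M.snd (-b ::ₘ _))]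
    convert this using 3 <;> ring
  approx' s hs a ha y z := by
    have := M.approx' (s.map Neg.neg) (by simpa using hs) (-a) (mem_map_of_mem _ ha) (-y) (-z)
    rw [map_map] at this
    rw [← abs_neg (a - _), ← abs_neg (a - -M.snd _)]
    have e : ∀ u v : ℝ, |-u - -v| = |u - v| := fun u v => by
      rw [← abs_neg (u - v)]; congr 1; ring
    simp only [Function.comp_def, e] at this
    convert this using 3 <;> ring
  one_le_ratio := M.one_le_ratio

variable {M}

lemma places_reflect {a : ℝ} {s : Multiset ℝ} :
    M.reflect.Places a s ↔ M.Places (-a) (s.map Neg.neg) := by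
  simp only [Places, reflect, neg_eq_iff_eq_neg]

lemma cost_nonneg (a : ℝ) (s : Multiset ℝ) : 0 ≤ M.cost a s :=
  le_min (abs_nonneg _) (abs_nonneg _)

lemma cost_le_of_places {e : ℝ} {s : Multiset ℝ} (h : M.Places e s) (a : ℝ) :
    M.cost a s ≤ |a - e| := by
  rcases h with rfl | rfl
  exacts [min_le_left _ _, min_le_right _ _]

lemma exists_places_cost_eq (M : NiceRule n) (a : ℝ) (s : Multiset ℝ) :
    ∃ e, M.Places e s ∧ M.cost a s = |a - e| := by
  rcases min_choice |a - M.fst s| |a - M.snd s| with h | h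
  exacts [⟨_, Or.inl rfl, h⟩, ⟨_, Or.inr rfl, h⟩]

lemma exists_places_of_cost_le {a d : ℝ} {s : Multiset ℝ} (h : M.cost a s ≤ d) :
    ∃ e, M.Places e s ∧ |a - e| ≤ d := by
  obtain ⟨e, he, hc⟩ := M.exists_places_cost_eq a s
  exact ⟨e, he, hc ▸ h⟩

lemma places_of_cost_le_zero {a : ℝ} {s : Multiset ℝ} (h : M.cost a s ≤ 0) : M.Places a s := by
  obtain ⟨e, he, hc⟩ := exists_places_of_cost_le h
  rwa [sub_eq_zero.1 (abs_nonpos_iff.1 hc)]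

lemma cost_eq_zero {a : ℝ} {s : Multiset ℝ} (h : M.Places a s) : M.cost a s = 0 :=
  le_antisymm (by simpa using cost_le_of_places h a) (cost_nonneg _ _)

/-- There are only two facilities. -/
lemma Places.eq_or_eq {a b c : ℝ} {s : Multiset ℝ} (ha : M.Places a s) (hb : M.Places b s)
    (hab : a ≠ b) (hc : M.Places c s) : c = a ∨ c = b := by
  rcases ha with rfl | rfl <;> rcases hb with rfl | rfl <;> rcases hc with rfl | rfl <;> simp_all

/-- Agents at a common location do not gain by any joint deviation. -/
lemma group_strategyproof (a : ℝ) : ∀ (t s : Multiset ℝ), t.card + s.card = n →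
    M.cost a (replicate t.card a + s) ≤ M.cost a (t + s) := by
  intro t
  induction t using Multiset.induction_on with
  | empty => intro s _; simp
  | cons b t ih =>
    intro s hs
    rw [card_cons] at hs
    have h1 := ih (a ::ₘ s) (by rw [card_cons]; omega)
    have h2 := M.strategyproof' a b (t + s) (by rw [card_add]; omega)
    rw [card_cons, replicate_succ, cons_add, cons_add, ← add_cons]
    refine h1.trans ?_
    rw [add_cons]
    exact h2

lemma group_strategyproof' {m : ℕ} (a : ℝ) {t s : Multiset ℝ} (ht : t.card = m)
    (hs : m + s.card = n) : M.cost a (replicate m a + s) ≤ M.cost a (t + s) := by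
  subst ht
  exact group_strategyproof a t s hs

/-- Moving agents to a facility does not remove that facility. -/
lemma Places.gather {m : ℕ} {a : ℝ} {t s : Multiset ℝ} (h : M.Places a (t + s))
    (ht : t.card = m) (hs : m + s.card = n) : M.Places a (replicate m a + s) :=
  places_of_cost_le_zero ((group_strategyproof' a ht hs).trans (cost_eq_zero h).le)

lemma cost_le_ratio_mul {s : Multiset ℝ} (hs : s.card = n) {a : ℝ} (ha : a ∈ s) (y z : ℝ) :
    M.cost a s ≤ M.ratio * (s.map fun x => min |x - y| |x - z|).sum :=
  M.approx' s hs a ha y z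

lemma cost_le_of_near {s : Multiset ℝ} (hs : s.card = n) {y z d : ℝ}
    (h : ∀ x ∈ s, |x - y| ≤ d ∨ |x - z| ≤ d) {a : ℝ} (ha : a ∈ s) :
    M.cost a s ≤ M.ratio * (n * d) := by
  refine (cost_le_ratio_mul hs ha y z).trans
    (mul_le_mul_of_nonneg_left ?_ (zero_le_one.trans M.one_le_ratio))
  refine (sum_le_card_nsmul _ d ?_).trans (by rw [card_map, hs, nsmul_eq_mul])
  intro u hu
  obtain ⟨x, hx, rfl⟩ := mem_map.1 hu
  exact min_le_iff.2 (h x hx)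

/-- A profile with at most two locations has optimal cost zero. -/
lemma places_of_forall_eq_or_eq {s : Multiset ℝ} (hs : s.card = n) {y z : ℝ}
    (h : ∀ x ∈ s, x = y ∨ x = z) {a : ℝ} (ha : a ∈ s) : M.Places a s := by
  apply places_of_cost_le_zero
  refine (cost_le_of_near (d := 0) hs (y := y) (z := z) (fun x hx => ?_) ha).trans (by simp)
  rcases h x hx with rfl | rfl
  · simp
  · simp

/-! ### Image sets and holes -/

variable (M) in
/-- The locations at which a group of `m` agents can obtain a facility by reporting it jointly,
when the other reports are `s`. -/
def image (m : ℕ) (s : Multiset ℝ) : Set ℝ := {z | M.Places z (replicate m z + s)}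

lemma mem_image_of_places {m : ℕ} {a : ℝ} {t s : Multiset ℝ} (h : M.Places a (t + s))
    (ht : t.card = m) (hs : m + s.card = n) : a ∈ M.image m s :=
  h.gather ht hs

lemma cost_le_of_mem_image {m : ℕ} {s : Multiset ℝ} (hs : m + s.card = n) {e : ℝ}
    (he : e ∈ M.image m s) (z : ℝ) : M.cost z (replicate m z + s) ≤ |z - e| :=
  (group_strategyproof' z (card_replicate m e) hs).trans (cost_le_of_places he z)

lemma exists_mem_image {m : ℕ} {s : Multiset ℝ} (hs : m + s.card = n) (z : ℝ) :
    ∃ e ∈ M.image m s, M.Places e (replicate m z + s) ∧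
      M.cost z (replicate m z + s) = |z - e| := by
  obtain ⟨e, he, hc⟩ := M.exists_places_cost_eq z (replicate m z + s)
  exact ⟨e, mem_image_of_places he (card_replicate _ _) hs, he, hc⟩

lemma isClosed_image {m : ℕ} {s : Multiset ℝ} (hs : m + s.card = n) :
    IsClosed (M.image m s) := by
  refine isClosed_of_closure_subset fun z hz => places_of_cost_le_zero ?_
  refine le_of_forall_pos_le_add fun ε hε => ?_
  obtain ⟨e, he, hd⟩ := Metric.mem_closure_iff.1 hz ε hε
  rw [Real.dist_eq] at hd
  linarith [cost_le_of_mem_image hs he z]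

/-- A point outside the image set lies in a hole whose endpoints belong to the image set. -/
lemma exists_hole {m : ℕ} {s : Multiset ℝ} (hs : m + s.card = n) {z a b : ℝ}
    (hz : z ∉ M.image m s) (ha : a ∈ M.image m s) (hb : b ∈ M.image m s) (haz : a ≤ z)
    (hzb : z ≤ b) :
    ∃ l r, l ∈ M.image m s ∧ r ∈ M.image m s ∧ a ≤ l ∧ l < z ∧ z < r ∧ r ≤ b ∧
      ∀ x, l < x → x < r → x ∉ M.image m s := by
  have hc := isClosed_image (M := M) hs
  obtain ⟨l, ⟨hl, hal, hlz⟩, hmax⟩ := (isCompact_Icc.inter_left hc).exists_isGreatest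
    (s := M.image m s ∩ Set.Icc a z) ⟨a, ha, le_rfl, haz⟩
  obtain ⟨r, ⟨hr, hzr, hrb⟩, hmin⟩ := (isCompact_Icc.inter_left hc).exists_isLeast
    (s := M.image m s ∩ Set.Icc z b) ⟨b, hb, hzb, le_rfl⟩
  refine ⟨l, r, hl, hr, hal, hlz.lt_of_ne ?_, hzr.lt_of_ne ?_, hrb, fun x hlx hxr hx => ?_⟩
  · rintro rfl; exact hz hl
  · rintro rfl; exact hz hr
  · rcases le_total x z with h | h
    · exact absurd (hmax ⟨hx, hal.trans hlx.le, h⟩) (not_le.2 hlx)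
    · exact absurd (hmin ⟨hx, h, hxr.le.trans hrb⟩) (not_le.2 hxr)

lemma places_left_of_hole {m : ℕ} {s : Multiset ℝ} (hs : m + s.card = n) {l r x : ℝ}
    (hl : l ∈ M.image m s) (hlr : ∀ x, l < x → x < r → x ∉ M.image m s) (hlx : l < x)
    (hx : x < (l + r) / 2) : M.Places l (replicate m x + s) := by
  obtain ⟨e, he, hp, hc⟩ := exists_mem_image (M := M) hs x
  have h := cost_le_of_mem_image hs hl x
  rw [hc, abs_of_pos (sub_pos.2 hlx)] at h
  obtain ⟨h1, h2⟩ := abs_le.1 h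
  have : ¬ l < e := fun hle => hlr e hle (by linarith) he
  rwa [show l = e by linarith]

lemma places_right_of_hole {m : ℕ} {s : Multiset ℝ} (hs : m + s.card = n) {l r x : ℝ}
    (hr : r ∈ M.image m s) (hlr : ∀ x, l < x → x < r → x ∉ M.image m s)
    (hx : (l + r) / 2 < x) (hxr : x < r) : M.Places r (replicate m x + s) := by
  obtain ⟨e, he, hp, hc⟩ := exists_mem_image (M := M) hs x
  have h := cost_le_of_mem_image hs hr x
  rw [hc, abs_of_neg (sub_neg.2 hxr)] at h
  obtain ⟨h1, h2⟩ := abs_le.1 h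
  have : ¬ e < r := fun hle => hlr e (by linarith) hle he
  rwa [show r = e by linarith]

/-- A group far enough to the right is served far to the right, since the optimal cost stays
bounded when the group moves. -/
lemma exists_lt_mem_image {m : ℕ} {s : Multiset ℝ} (hs : m + s.card = n) (hm : m ≠ 0) (K : ℝ) :
    ∃ e ∈ M.image m s, K < e := by
  set C := M.ratio * (s.map fun x => |x|).sum with hC
  have hρ : 0 ≤ M.ratio := zero_le_one.trans M.one_le_ratio
  set k := K + C + 1 with hk
  obtain ⟨e, he, -, hc⟩ := exists_mem_image (M := M) hs k
  refine ⟨e, he, ?_⟩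
  have h1 : M.cost k (replicate m k + s) ≤ C := by
    refine (cost_le_ratio_mul (by simp [hs]) (by simp [mem_replicate, hm]) 0 k).trans ?_
    refine mul_le_mul_of_nonneg_left ?_ hρ
    rw [map_add, sum_add, map_replicate]
    simp only [sub_self, abs_zero, sub_zero]
    rw [min_eq_right (abs_nonneg k), sum_replicate, smul_zero, zero_add]
    exact sum_map_le_sum_map _ _ fun x _ => min_le_left _ _
  rw [hc] at h1
  have := (abs_le.1 h1).2
  linarith

end NiceRule

end FacilityLocation

namespace FacilityLocation
namespace NiceRule

open Multiset

variable {n : ℕ} {M : NiceRule n}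

/-! ### Two groups to the right of everybody else -/

/-- The reports `s` are completed by a group of `b` agents and a group of `c` agents, which report
locations to the right of `L`. When the two groups are close to each other compared with their
distance from `L`, a facility stays far to the left of them (`far`), and when they report the same
location they obtain a facility there (`diag`). -/
structure RightPair (M : NiceRule n) (s : Multiset ℝ) (b c : ℕ) (L γ : ℝ) : Prop where
  card_eq : c + (b + s.card) = n
  ne_zero : c ≠ 0
  γ_pos : 0 < γ
  γ_le : γ ≤ 1 / 4
  far : ∀ j k, L < j → j < k → k - j < γ * (j - L) →
    ∃ f, M.Places f (replicate c k + (replicate b j + s)) ∧ f ≤ (L + j) / 2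
  diag : ∀ j, L < j → M.Places j (replicate c j + (replicate b j + s))

/-- When the group of `b` agents is at `j`, the group of `c` agents obtains a facility at no point
of the interval `(j, r)`, but it does at `r`. The point `j` is called the starting point of the
hole. -/
structure Hole (M : NiceRule n) (s : Multiset ℝ) (b c : ℕ) (j r : ℝ) : Prop where
  lt : j < r
  mem : r ∈ M.image c (replicate b j + s)
  notMem : ∀ x, j < x → x < r → x ∉ M.image c (replicate b j + s)

lemma cost_left_le {s : Multiset ℝ} {b c : ℕ} (h : c + (b + s.card) = n) (j j' k : ℝ) :
    M.cost j (replicate c k + (replicate b j + s)) ≤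
      M.cost j (replicate c k + (replicate b j' + s)) := by
  rw [add_left_comm, add_left_comm (replicate c k)]
  exact group_strategyproof' j (card_replicate b j') (by rw [card_add, card_replicate]; omega)

namespace RightPair

variable {s : Multiset ℝ} {b c : ℕ} {L γ : ℝ} (H : RightPair M s b c L γ)
include H

lemma card_eq' (j : ℝ) : c + (replicate b j + s).card = n := by
  rw [card_add, card_replicate]; exact H.card_eq

lemma places_left {j r k : ℝ} (hj : L < j) (h : Hole M s b c j r) (hjk : j < k)
    (hk : k < (j + r) / 2) : M.Places j (replicate c k + (replicate b j + s)) :=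
  places_left_of_hole (H.card_eq' j) (H.diag j hj) h.notMem hjk hk

lemma places_right {j r k : ℝ} (h : Hole M s b c j r) (hk : (j + r) / 2 < k)
    (hkr : k < r) : M.Places r (replicate c k + (replicate b j + s)) :=
  places_right_of_hole (H.card_eq' j) h.mem h.notMem hk hkr

/-- Holes are long: otherwise the group at `j`, which would be served neither by the facility at
`r` nor by the one far to the left, would join the other group. -/
lemma hole_length {j r : ℝ} (hj : L < j) (h : Hole M s b c j r) :
    2 * γ * (j - L) ≤ r - j := by
  by_contra! hlt
  have hjr := h.lt
  have hγ := H.γ_le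
  obtain ⟨k, hk1, hk2⟩ := exists_between (a₁ := (j + r) / 2) (a₂ := min r (j + γ * (j - L)))
    (lt_min (by linarith) (by linarith))
  obtain ⟨hkr, hkγ⟩ := lt_min_iff.1 hk2
  have hr := H.places_right h hk1 hkr
  obtain ⟨f, hf, hfL⟩ := H.far j k hj (by linarith) (by linarith)
  have hcost : M.cost j (replicate c k + (replicate b j + s)) ≤ |j - k| :=
    (cost_left_le H.card_eq j k k).trans (cost_le_of_places (H.diag k (by linarith)) j)
  obtain ⟨e, he, hje⟩ := exists_places_of_cost_le hcost
  rw [abs_of_neg (by linarith : j - k < 0)] at hje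
  obtain ⟨h1, h2⟩ := abs_le.1 hje
  have h3 : γ * (j - L) ≤ 1 / 4 * (j - L) := mul_le_mul_of_nonneg_right hγ (by linarith)
  rcases hf.eq_or_eq hr (by linarith) he with rfl | rfl
  · linarith
  · linarith

/-- If the right group at `k` is not served, then a hole starts between the two groups. -/
lemma exists_hole_start {j k : ℝ} (hj : L < j) (hjk : j < k)
    (hk : ¬ M.Places k (replicate c k + (replicate b j + s))) :
    ∃ t r, j ≤ t ∧ t < k ∧ Hole M s b c t r := by
  obtain ⟨e, he, hke⟩ := exists_lt_mem_image (M := M) (H.card_eq' j) H.ne_zero k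
  obtain ⟨t, r, ht, hr, hjt, htk, hkr, -, hhole⟩ :=
    exists_hole (H.card_eq' j) (z := k) hk (H.diag j hj) he hjk.le hke.le
  have hLt : L < t := hj.trans_le hjt
  -- Moving the left group to the start of the hole keeps the facility there.
  have hserved : ∀ x, t < x → x < (t + r) / 2 →
      M.Places t (replicate c x + (replicate b t + s)) := by
    intro x htx hx
    have h1 := places_left_of_hole (H.card_eq' j) ht hhole htx hx
    refine places_of_cost_le_zero ((cost_left_le H.card_eq t j x).trans (cost_eq_zero h1).le)
  set δ := min ((t + r) / 2) (t + γ * (t - L)) with hδ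
  have hpos : 0 < γ * (t - L) := mul_pos H.γ_pos (by linarith)
  have htδ : t < δ := lt_min (by linarith) (by linarith)
  have hempty : ∀ x, t < x → x < δ → x ∉ M.image c (replicate b t + s) := by
    intro x htx hxδ hx
    obtain ⟨hx1, hx2⟩ := lt_min_iff.1 hxδ
    obtain ⟨f, hf, hfL⟩ := H.far t x hLt htx (by linarith)
    rcases (hserved x htx hx1).eq_or_eq hx htx.ne hf with rfl | rfl <;> linarith
  obtain ⟨x, htx, hxδ⟩ := exists_between htδ
  obtain ⟨e', he', hxe'⟩ := exists_lt_mem_image (M := M) (H.card_eq' t) H.ne_zero x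
  obtain ⟨l, r', hl, hr', htl, hlx, hxr', -, hhole'⟩ :=
    exists_hole (H.card_eq' t) (hempty x htx hxδ) (H.diag t hLt) he' htx.le hxe'.le
  obtain rfl : t = l := by
    by_contra hne
    exact hempty l (lt_of_le_of_ne htl hne) (hlx.trans hxδ) hl
  exact ⟨t, r', hjt, htk, htx.trans hxr', hr', hhole'⟩

/-- Starting points of holes propagate to the right by small steps. -/
lemma exists_hole_step {j r j' k : ℝ} (hj : L < j) (h : Hole M s b c j r) (hjj' : j < j')
    (hk : 2 * j' - j < k) (hkγ : k < j + γ * (j - L)) :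
    ∃ t u, j' ≤ t ∧ t < k ∧ Hole M s b c t u := by
  have hγ := H.γ_le
  have hγ0 := H.γ_pos
  have hlen := H.hole_length hj h
  refine H.exists_hole_start (hj.trans hjj') (by linarith) fun hpk => ?_
  have h3 : γ * (j - L) ≤ 1 / 4 * (j - L) := mul_le_mul_of_nonneg_right hγ (by linarith)
  have h4 : γ * (j - L) ≤ γ * (j' - L) := mul_le_mul_of_nonneg_left (by linarith) hγ0.le
  have hpj := H.places_left hj h (k := k) (by linarith) (by linarith)
  obtain ⟨f, hf, hfL⟩ := H.far j' k (hj.trans hjj') (by linarith) (by linarith)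
  obtain ⟨e, he, hje⟩ := exists_places_of_cost_le
    ((cost_left_le H.card_eq j' j k).trans (cost_le_of_places hpj j'))
  rw [abs_of_pos (by linarith : 0 < j' - j)] at hje
  obtain ⟨h1, h2⟩ := abs_le.1 hje
  rcases hf.eq_or_eq hpk (by linarith) he with rfl | rfl <;> linarith

/-- If the midpoint of the hole increases between two nearby starting points, then for a right
group between the two midpoints the left group keeps a facility nearby, although the other facility
is not to the left of it. -/
lemma exists_places_near {j r j' r' : ℝ} (hj : L < j) (h : Hole M s b c j r)
    (h' : Hole M s b c j' r') (hjj' : j < j') (hγj : j' - j < γ * (j - L))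
    (hmid : j + r < j' + r') :
    ∃ k f u, j' < k ∧ k < u ∧ |j - f| ≤ j' - j ∧
      M.Places f (replicate c k + (replicate b j + s)) ∧
      M.Places u (replicate c k + (replicate b j + s)) := by
  have hlen := H.hole_length hj h
  have hjr := h.lt
  obtain ⟨k, hk1, hk2⟩ := exists_between (a₁ := (j + r) / 2) (a₂ := min r ((j' + r') / 2))
    (lt_min (by linarith) (by linarith))
  obtain ⟨hkr, hkm⟩ := lt_min_iff.1 hk2
  have hjk : j' < k := by linarith
  have hp' := H.places_left (hj.trans hjj') h' hjk hkm
  obtain ⟨f, hf, hjf⟩ := exists_places_of_cost_le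
    ((cost_left_le H.card_eq j j' k).trans (cost_le_of_places hp' j))
  rw [abs_of_neg (by linarith : j - j' < 0), neg_sub] at hjf
  exact ⟨k, f, r, hjk, hkr, hjf, hf, H.places_right h hk1 hkr⟩

/-- To the right of a starting point of a hole, such starting points are dense. -/
lemma exists_hole_mem_Ioo {t₀ r₀ x y : ℝ} (ht₀ : L < t₀) (h₀ : Hole M s b c t₀ r₀)
    (hx : t₀ ≤ x) (hxy : x < y) : ∃ t r, x < t ∧ t < y ∧ Hole M s b c t r := by
  have hγ0 := H.γ_pos
  have hpos : 0 < γ * (t₀ - L) := mul_pos hγ0 (by linarith)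
  obtain ⟨δ, hδ0, hδ⟩ := exists_between (lt_min (sub_pos.2 hxy) hpos)
  obtain ⟨hδy, hδγ⟩ := lt_min_iff.1 hδ
  set S := {t | t₀ ≤ t ∧ t ≤ x ∧ ∃ r, Hole M s b c t r} with hS
  have hbdd : BddAbove S := ⟨x, fun t ht => ht.2.1⟩
  -- The step is taken from a point of `S` close to its supremum, so that it leaves `S`.
  obtain ⟨t, ⟨ht₀t, htx, r, h⟩, htS⟩ := exists_lt_of_lt_csSup (s := S) ⟨t₀, le_rfl, hx, r₀, h₀⟩
    (show sSup S - δ / 4 < sSup S by linarith)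
  have hle : γ * (t₀ - L) ≤ γ * (t - L) := mul_le_mul_of_nonneg_left (by linarith) hγ0.le
  obtain ⟨t', r', h1, h2, h'⟩ := H.exists_hole_step (j' := t + δ / 4) (k := t + δ)
    (by linarith) h (by linarith) (by linarith) (by linarith)
  refine ⟨t', r', ?_, by linarith, h'⟩
  by_contra! hle'
  have := le_csSup hbdd (show t' ∈ S from ⟨by linarith, hle', r', h'⟩)
  linarith

/-- If there is a hole, then, arbitrarily far to the right, the midpoint of the hole increases
between two nearby starting points, since it lies to the right of the starting point. -/
lemma exists_hole_mid_lt {t₀ r₀ : ℝ} (ht₀ : L < t₀) (h₀ : Hole M s b c t₀ r₀) (K : ℝ) :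
    ∃ j r j' r', K < j ∧ t₀ < j ∧ j < j' ∧ j' - j < γ * (j - L) ∧ Hole M s b c j r ∧
      Hole M s b c j' r' ∧ j + r < j' + r' := by
  have hγ0 := H.γ_pos
  obtain ⟨t₁, r₁, hlt, -, h₁⟩ := H.exists_hole_mem_Ioo ht₀ h₀ (le_max_left t₀ K)
    (lt_add_one (max t₀ K))
  obtain ⟨h01, hK⟩ := max_lt_iff.1 hlt
  by_contra! hcon
  set S := {t | t₁ ≤ t ∧ ∃ r, Hole M s b c t r ∧ t + r ≤ t₁ + r₁} with hS
  have hbdd : BddAbove S := ⟨(t₁ + r₁) / 2, fun t ⟨_, r, h, _⟩ => by linarith [h.lt]⟩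
  have hpos : 0 < γ * (t₁ - L) := mul_pos hγ0 (by linarith)
  obtain ⟨t, ⟨ht₁t, r, h, hle⟩, htS⟩ := exists_lt_of_lt_csSup (s := S) ⟨t₁, le_rfl, r₁, h₁, le_rfl⟩
    (show sSup S - γ * (t₁ - L) / 2 < sSup S by linarith)
  have hmul : γ * (t₁ - L) ≤ γ * (t - L) := mul_le_mul_of_nonneg_left (by linarith) hγ0.le
  obtain ⟨t', r', h1, h2, h'⟩ := H.exists_hole_mem_Ioo (x := t + γ * (t₁ - L) / 2)
    (y := t + γ * (t₁ - L)) (by linarith) h (by linarith) (by linarith)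
  have hS' : t' ∈ S := ⟨by linarith, r', h',
    (hcon t r t' r' (by linarith) (by linarith) (by linarith) (by linarith) h h').trans hle⟩
  linarith [le_csSup hbdd hS']

end RightPair

/-- Two groups to the right of everybody else: if one of the facilities never goes to the right of
`L`, then the rightmost group is served exactly. -/
theorem places_right_of_forall_le {s : Multiset ℝ} {b c : ℕ} {L : ℝ}
    (hcard : c + (b + s.card) = n) (hc : c ≠ 0)
    (hleft : ∀ j k, L < j → j < k →
      ∃ f, M.Places f (replicate c k + (replicate b j + s)) ∧ f ≤ L)
    (hdiag : ∀ j, L < j → M.Places j (replicate c j + (replicate b j + s)))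
    {j k : ℝ} (hj : L < j) (hjk : j < k) :
    M.Places k (replicate c k + (replicate b j + s)) := by
  have H : RightPair M s b c L (1 / 4) :=
    ⟨hcard, hc, by norm_num, le_rfl, fun j k hj hjk _ => by
      obtain ⟨f, hf, hfL⟩ := hleft j k hj hjk
      exact ⟨f, hf, by linarith⟩, hdiag⟩
  by_contra hk
  obtain ⟨t, r, hjt, -, h⟩ := H.exists_hole_start hj hjk hk
  obtain ⟨j, r, j', r', -, hj, hjj', hγ, h, h', hmid⟩ :=
    H.exists_hole_mid_lt (hj.trans_le hjt) h 0
  obtain ⟨k, f, u, hjk, hku, hjf, hf, hu⟩ :=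
    H.exists_places_near (by linarith) h h' hjj' hγ hmid
  obtain ⟨e, he, heL⟩ := hleft j k (by linarith) (by linarith)
  have := (abs_le.1 hjf).2
  rcases hf.eq_or_eq hu (by linarith [(abs_le.1 hjf).1]) he with rfl | rfl <;> linarith

end NiceRule
end FacilityLocation

namespace FacilityLocation
namespace NiceRule

open Multiset

variable {n : ℕ} {M : NiceRule n}

/-! ### Profiles with three locations -/

/-- With `a`, `b` and `c` agents at `L < j < k`, the rightmost group is served exactly. -/
def MaxServed (M : NiceRule n) (a b c : ℕ) : Prop :=
  ∀ L j k, L < j → j < k → M.Places k (replicate c k + (replicate b j + replicate a L))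

/-- With `a`, `b` and `c` agents at `L < j < k`, the leftmost group is served exactly. -/
def MinServed (M : NiceRule n) (a b c : ℕ) : Prop :=
  ∀ L j k, L < j → j < k → M.Places L (replicate c k + (replicate b j + replicate a L))

lemma maxServed_reflect {a b c : ℕ} : M.reflect.MaxServed c b a ↔ M.MinServed a b c := by
  have e : ∀ L j k : ℝ, (replicate a L + (replicate b j + replicate c k)) =
      replicate c k + (replicate b j + replicate a L) := fun L j k => by
    rw [add_comm, add_comm (replicate b j), add_assoc]
  constructor
  · intro h L j k hLj hjk
    have := h (-k) (-j) (-L) (neg_lt_neg hjk) (neg_lt_neg hLj)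
    rw [places_reflect] at this
    simpa [e] using this
  · intro h L j k hLj hjk
    have := h (-k) (-j) (-L) (neg_lt_neg hjk) (neg_lt_neg hLj)
    rw [places_reflect]
    simpa [e] using this

/-- The separation at which the bounded approximation ratio becomes effective. -/
noncomputable def sep (M : NiceRule n) : ℝ := 1 / (4 * (M.ratio * n))

/-- A single far group to the left: the approximation ratio forces a facility close to it. -/
lemma rightPair_replicate {a b c : ℕ} (ha : a ≠ 0) (hc : c ≠ 0) (hn : a + b + c = n) (L : ℝ) :
    RightPair M (replicate a L) b c L M.sep := by
  have hn1 : (1 : ℝ) ≤ n := by exact_mod_cast (by omega : 1 ≤ n)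
  have hρ := one_le_mul_of_one_le_of_one_le M.one_le_ratio hn1
  have hsep : M.sep * (4 * (M.ratio * n)) = 1 := by
    rw [sep, one_div, inv_mul_cancel₀ (by positivity)]
  have hcard : ∀ j k : ℝ, (replicate c k + (replicate b j + replicate a L)).card = n := by
    intro j k; simp; omega
  refine ⟨by simp; omega, hc, by unfold sep; positivity, ?_, ?_, ?_⟩
  · unfold sep
    exact one_div_le_one_div_of_le (by norm_num) (by linarith)
  · intro j k hLj hjk hkj
    have hle := cost_le_of_near (M := M) (hcard j k) (a := L) (y := L) (z := j) (d := k - j) (by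
      intro x hx
      simp only [mem_add, mem_replicate] at hx
      rcases hx with ⟨-, rfl⟩ | ⟨-, rfl⟩ | ⟨-, rfl⟩
      · right; rw [abs_of_pos (by linarith)]
      · right; simpa using hjk.le
      · left; simpa using hjk.le) (by simp [mem_replicate, ha])
    obtain ⟨f, hf, hLf⟩ := exists_places_of_cost_le hle
    refine ⟨f, hf, ?_⟩
    have h1 := (abs_le.1 hLf).1
    have h2 : M.ratio * n * (k - j) ≤ M.ratio * n * (M.sep * (j - L)) :=
      mul_le_mul_of_nonneg_left hkj.le (by linarith)
    have h3 : M.ratio * n * (M.sep * (j - L)) = (j - L) / 4 := by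
      linear_combination ((j - L) / 4) * hsep
    linarith
  · intro j hj
    refine places_of_forall_eq_or_eq (hcard j j) (y := j) (z := L) (fun x hx => ?_)
      (by simp [mem_replicate, hc])
    simp only [mem_add, mem_replicate] at hx
    tauto

lemma MinServed.maxServed {a b c : ℕ} (h : M.MinServed a b c) (ha : a ≠ 0) (hc : c ≠ 0)
    (hn : a + b + c = n) : M.MaxServed a b c := by
  intro L j k hLj hjk
  have H := rightPair_replicate (M := M) ha hc hn L
  exact places_right_of_forall_le H.card_eq hc (fun j k hj hk => ⟨L, h L j k hj hk, le_rfl⟩)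
    H.diag hLj hjk

lemma MaxServed.minServed {a b c : ℕ} (h : M.MaxServed a b c) (ha : a ≠ 0) (hc : c ≠ 0)
    (hn : a + b + c = n) : M.MinServed a b c := by
  refine maxServed_reflect.1 (MinServed.maxServed (maxServed_reflect.1 ?_) hc ha (by omega))
  intro L j k hLj hjk
  have := h L j k hLj hjk
  rw [places_reflect, places_reflect, map_map]
  simpa using this

/-- Agents of the leftmost group may join the rightmost one. -/
lemma MaxServed.move {a b c d : ℕ} (h : M.MaxServed (a + d) b c) (hn : a + d + b + c = n) :
    M.MaxServed a b (c + d) := by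
  intro L j k hLj hjk
  have := h L j k hLj hjk
  refine Places.gather (t := replicate c k + replicate d L) ?_ (by simp) (by simp; omega)
  convert this using 1
  rw [replicate_add]
  abel

lemma MinServed.move {a b c d : ℕ} (h : M.MinServed a b (c + d)) (hn : a + d + b + c = n) :
    M.MinServed (a + d) b c :=
  maxServed_reflect.1 ((maxServed_reflect.2 h).move (by omega))

/-- A single agent in the middle cannot prevent two agents on the right from being served.

Otherwise, with `a` agents at `A` and one at `i`, there is a hole that starts at `i`: two agents at
`k` are not served for `k` slightly to the right of `i`, hence one agent at `k` and one at any `z`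
do not yield a facility at `k` either. The case `z = A` is a hole for single agents, seen from
`a + 1` agents at `A`, and such holes produce, far to the right of `A`, two agents at `j < z` for
which the group at `A` has no facility nearby. By strategyproofness this group is not served when
it is at `e`, where `i < e`, so that, seen from `z`, there are long holes that start arbitrarily
close to `i` and end to the left of `A`. Let one of them start at `k`, where `i < k < e`. Then `k`
is served when the agent at `i` joins the group at `A`, so this agent has a facility at distance at
most `k - i` in the original profile. It is not at `k`, and the hole excludes every position
slightly to the left of `k`. -/
lemma maxServed_one_two {a : ℕ} (ha : a ≠ 0) (M : NiceRule (a + 3)) : M.MaxServed a 1 2 := by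
  intro A i₀ k₀ hAi₀ hik₀
  by_contra hk₀
  have H₂ := rightPair_replicate (M := M) ha two_ne_zero (b := 1) (by omega) A
  have H₁ := rightPair_replicate (M := M) a.succ_ne_zero one_ne_zero (b := 1) (by omega) A
  have hγ0 := H₂.γ_pos
  have hγ := H₂.γ_le
  set γ := M.sep with hγdef
  obtain ⟨i, r, hi₀, -, hi⟩ := H₂.exists_hole_start hAi₀ hik₀ hk₀
  have hAi : A < i := hAi₀.trans_le hi₀
  have hir := hi.lt
  have hnot : ∀ k z, i < k → k < r →
      ¬ M.Places k ((replicate 1 k + replicate 1 z) + (replicate 1 i + replicate a A)) :=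
    fun k z hik hkr h => hi.notMem k hik hkr
      (mem_image_of_places h (by simp) (by simp; omega))
  obtain ⟨e, hie, he⟩ := exists_between (lt_min hir (by linarith : i < i + (i - A)))
  obtain ⟨her, heA⟩ := lt_min_iff.1 he
  -- Seen from the right, there is a hole starting to the right of `i`.
  obtain ⟨t₀, r₀, hit₀, -, h₀⟩ := H₁.exists_hole_start hAi hie fun h => hnot e A hie her (by
    convert h using 1
    rw [Nat.succ_eq_add_one, replicate_add]
    abel)
  obtain ⟨j, r₁, j', r₂, hKj, ht₀j, hjj', hj'γ, h₁, h₂, hmid⟩ :=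
    H₁.exists_hole_mid_lt (by linarith) h₀ (e + (e - A) / γ)
  obtain ⟨z, f, u, hj'z, hzu, hjf, hf, hu⟩ :=
    H₁.exists_places_near (by linarith) h₁ h₂ hjj' hj'γ hmid
  have hdiv : 4 * (e - A) ≤ (e - A) / γ := by
    rw [le_div_iff₀ hγ0]
    linarith [mul_le_mul_of_nonneg_left hγ (by linarith : 0 ≤ 4 * (e - A))]
  have hγj : γ * (j - A) ≤ 1 / 4 * (j - A) := mul_le_mul_of_nonneg_right hγ (by linarith)
  have hef : e < f := by linarith [(abs_le.1 hjf).2]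
  have hfu : f ≠ u := by linarith [(abs_le.1 hjf).1] |> fun h : f < u => h.ne
  have hzγ : e - A < γ * (z - e) := by
    have : (e - A) / γ < z - e := by linarith
    rwa [div_lt_iff₀' hγ0] at this
  -- The group now moves, in the mirror, from `e` towards `A`.
  have H₃ : RightPair M.reflect (replicate 1 (-z)) 1 (a + 1) (-z) γ :=
    rightPair_replicate one_ne_zero a.succ_ne_zero (by omega) (-z)
  have hmap : ∀ x y : ℝ, (replicate (a + 1) (-x) + (replicate 1 (-y) + replicate 1 (-z))).map
      Neg.neg = replicate (a + 1) x + (replicate 1 y + replicate 1 z) := by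
    intro x y
    simp only [Multiset.map_add, map_replicate, neg_neg]
  have hmirror : ¬ M.reflect.Places (-e)
      (replicate (a + 1) (-e) + (replicate 1 (-j) + replicate 1 (-z))) := by
    rw [places_reflect, neg_neg, hmap]
    intro h
    have hle := (group_strategyproof' (M := M) A (card_replicate (a + 1) e)
      (s := replicate 1 j + replicate 1 z) (by simp)).trans (cost_le_of_places h A)
    obtain ⟨g, hg, hAg⟩ := exists_places_of_cost_le hle
    rw [abs_of_neg (by linarith : A - e < 0)] at hAg
    have hg' : M.Places g (replicate 1 z + (replicate 1 j + replicate (a + 1) A)) := by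
      convert hg using 1
      abel
    have := (abs_le.1 hAg).1
    rcases hf.eq_or_eq hu hfu hg' with rfl | rfl <;> linarith
  obtain ⟨t₁, u₁, hjt₁, ht₁e, h₃⟩ := H₃.exists_hole_start (by linarith) (by linarith) hmirror
  obtain ⟨t, l, het, hti, h₄⟩ := H₃.exists_hole_mem_Ioo (by linarith) h₃ ht₁e.le
    (neg_lt_neg hie)
  obtain ⟨k, rfl⟩ : ∃ k, t = -k := ⟨-t, (neg_neg t).symm⟩
  have hke : k < e := neg_lt_neg_iff.1 het
  have hik : i < k := neg_lt_neg_iff.1 hti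
  have hlen := H₃.hole_length (by linarith) h₄
  have hzk : γ * (z - e) ≤ γ * (-k - -z) := mul_le_mul_of_nonneg_left (by linarith) hγ0.le
  have hk : M.Places k (replicate (a + 1) A + (replicate 1 k + replicate 1 z)) := by
    have := H₃.places_left (by linarith) h₄ (k := -A) (by linarith) (by linarith)
    rwa [places_reflect, neg_neg, hmap] at this
  -- The agent at `i` may join those at `A`.
  have hcost : M.cost i (replicate 1 i +
      ((replicate 1 k + replicate 1 z) + replicate a A)) ≤ |i - k| := by
    refine (group_strategyproof' i (card_replicate 1 A) (by simp; omega)).trans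
      (cost_le_of_places ?_ i)
    convert hk using 1
    rw [replicate_add]
    abel
  obtain ⟨g, hg, hig⟩ := exists_places_of_cost_le hcost
  rw [abs_of_neg (by linarith : i - k < 0)] at hig
  obtain ⟨hg1, hg2⟩ := abs_le.1 hig
  rw [add_left_comm] at hg
  rcases eq_or_lt_of_le (by linarith : g ≤ k) with rfl | hgk
  · exact hnot g z hik (hke.trans her) hg
  · refine h₄.notMem (-g) (by linarith) (by linarith) ?_
    change M.reflect.Places _ _
    rw [places_reflect, neg_neg, hmap]
    refine Places.gather (t := replicate 1 i + replicate a A) ?_ (by simp [add_comm]) (by simp)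
    convert hg using 1
    exact add_comm _ _

end NiceRule
end FacilityLocation

namespace FacilityLocation
namespace NiceRule

open Multiset

variable {n : ℕ} {M : NiceRule n}

/-- A single agent in the middle does not matter: the sizes of the two other groups are adjusted by
moves of agents between the extremes. -/
lemma maxServed_one (hn : 4 ≤ n) {a c : ℕ} (ha : a ≠ 0) (hc : c ≠ 0) (hac : a + 1 + c = n) :
    M.MaxServed a 1 c := by
  obtain ⟨d, rfl⟩ : ∃ d, n = (d + 1) + 3 := ⟨n - 4, by omega⟩
  have h : M.MaxServed (1 + d) 1 2 := by
    rw [add_comm 1 d]; exact maxServed_one_two (by omega) M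
  have h' : M.MinServed 1 1 (2 + d) :=
    (h.move (by omega)).minServed one_ne_zero (by omega) (by omega)
  obtain ⟨a, rfl⟩ := Nat.exists_eq_add_one_of_ne_zero ha
  obtain rfl : d = c + a - 2 := by omega
  have h'' : M.MinServed 1 1 (c + a) := by convert h' using 1; omega
  rw [add_comm a 1] at *
  exact (h''.move (by omega)).maxServed (by omega) hc (by omega)

/-- If the middle group can be split into two parts such that the right group is served when the
right part joins it, and the left group is served when the left part joins it, then the right group
is served.

When the two parts are at different locations `y < j`, the agents at `L` may join those at `y` and
would be served there. Hence a facility stays to the left of `y`, and the right group is served.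
Now let `t` be the starting point of a hole. With the parts at `t - ε` and `t`, and the right group
at `t + ε`, there are facilities close to `L` and at `t + ε`; but the part at `t - ε` can obtain one
at `t` by joining the other part. -/
lemma MaxServed.of_split {a b c d : ℕ} (h : M.MaxServed a b (c + d))
    (h' : M.MinServed (a + b) c d) (ha : a ≠ 0) (hd : d ≠ 0)
    (hn : a + b + c + d = n) : M.MaxServed a (b + c) d := by
  have four : ∀ L y j k, L < y → y < j → j < k →
      M.Places k (replicate d k + (replicate c j + (replicate b y + replicate a L))) := by
    intro L y j k hLy hyj hjk
    refine places_right_of_forall_le (L := y) (by simp; omega) hd ?_ ?_ hyj hjk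
    · intro j k hyj hjk
      have h1 := (group_strategyproof' (M := M) L (card_replicate a y)
        (s := replicate d k + (replicate c j + replicate b y)) (by simp; omega)).trans
        (cost_le_of_places (e := y) (by
          convert h' y j k hyj hjk using 1
          rw [replicate_add]; abel) L)
      obtain ⟨f, hf, hLf⟩ := exists_places_of_cost_le h1
      rw [abs_of_neg (by linarith : L - y < 0)] at hLf
      refine ⟨f, ?_, by linarith [(abs_le.1 hLf).1]⟩
      convert hf using 1
      abel
    · intro j hyj
      convert h L y j hLy hyj using 1
      rw [replicate_add]; abel
  intro L j₀ k₀ hLj₀ hjk₀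
  by_contra hk₀
  have H := rightPair_replicate (M := M) ha hd (b := b + c) (by omega) L
  obtain ⟨t, r, hjt, -, ht⟩ := H.exists_hole_start hLj₀ hjk₀ hk₀
  have hLt : L < t := hLj₀.trans_le hjt
  have htr := ht.lt
  have hρ : 0 < M.ratio * n + 2 := by
    have := M.one_le_ratio
    positivity
  -- The distance `ε` is so small that the approximation ratio forces a facility close to `L`.
  obtain ⟨ε, hε0, hε⟩ := exists_between
    (lt_min (by linarith : 0 < (r - t) / 2) (div_pos (sub_pos.2 hLt) hρ))
  obtain ⟨hεr, hεL⟩ := lt_min_iff.1 hε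
  rw [lt_div_iff₀ hρ] at hεL
  have hρε : 0 ≤ M.ratio * n * ε := by
    have := M.one_le_ratio
    positivity
  have hk := four L (t - ε) t (t + ε) (by linarith) (by linarith) (by linarith)
  have ht' := H.places_left hLt ht (k := t + ε) (by linarith) (by linarith)
  set S := replicate d (t + ε) + (replicate c t + (replicate b (t - ε) + replicate a L)) with hS
  have hy : M.cost (t - ε) S ≤ |t - ε - t| := by
    have h1 := (group_strategyproof' (M := M) (t - ε) (card_replicate b t)
      (s := replicate d (t + ε) + (replicate c t + replicate a L)) (by simp; omega)).trans
        (cost_le_of_places (e := t) (by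
          convert ht' using 1
          rw [replicate_add]; abel) _)
    have h2 : S = replicate b (t - ε) +
        (replicate d (t + ε) + (replicate c t + replicate a L)) := by
      rw [hS]
      abel
    rw [h2]
    exact h1
  obtain ⟨f, hf, hyf⟩ := exists_places_of_cost_le hy
  rw [abs_of_neg (by linarith : t - ε - t < 0)] at hyf
  obtain ⟨hyf1, hyf2⟩ := abs_le.1 hyf
  have hL : M.cost L S ≤ M.ratio * (n * ε) := by
    refine cost_le_of_near (y := L) (z := t) (by simp [hS]; omega) (fun x hx => ?_)
      (by simp [hS, mem_replicate, ha])
    simp only [hS, mem_add, mem_replicate] at hx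
    rcases hx with ⟨-, rfl⟩ | ⟨-, rfl⟩ | ⟨-, rfl⟩ | ⟨-, rfl⟩
    · right; rw [add_sub_cancel_left, abs_of_pos hε0]
    · right; simpa using hε0.le
    · right; rw [sub_sub_cancel_left, abs_neg, abs_of_pos hε0]
    · left; simpa using hε0.le
  obtain ⟨e, he, hLe⟩ := exists_places_of_cost_le hL
  have := (abs_le.1 hLe).1
  rcases hf.eq_or_eq hk (by linarith) he with rfl | rfl <;> linarith

/-- On profiles with three locations the rightmost one is served. -/
theorem maxServed (hn : 4 ≤ n) (M : NiceRule n) {a c : ℕ} (b : ℕ) (ha : a ≠ 0) (hb : b ≠ 0)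
    (hc : c ≠ 0) (habc : a + b + c = n) : M.MaxServed a b c := by
  induction b, Nat.one_le_iff_ne_zero.2 hb using Nat.le_induction generalizing a c with
  | base => exact maxServed_one hn ha hc habc
  | succ b hb' ih =>
    exact (ih ha (by omega) (by omega : 1 + c ≠ 0) (by omega)).of_split
      ((maxServed_one hn (by omega) hc (by omega)).minServed (by omega) hc (by omega))
      ha hc (by omega)

/-! ### Arbitrary profiles -/

lemma exists_eq_replicate_add_of_max {s : Multiset ℝ} (hs : s ≠ 0) :
    ∃ (k : ℝ) (c : ℕ) (t : Multiset ℝ), c ≠ 0 ∧ s = replicate c k + t ∧ (∀ x ∈ t, x < k) ∧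
      s.toFinset.card = t.toFinset.card + 1 := by
  have hne : s.toFinset.Nonempty := by rwa [toFinset_nonempty]
  set k := s.toFinset.max' hne with hk
  have hks : k ∈ s := mem_toFinset.1 (s.toFinset.max'_mem hne)
  have hlt : ∀ x ∈ s.filter (¬ · = k), x < k := fun x hx =>
    lt_of_le_of_ne (s.toFinset.le_max' x (mem_toFinset.2 (mem_filter.1 hx).1)) (mem_filter.1 hx).2
  have hdec : s = replicate (s.count k) k + s.filter (¬ · = k) := by
    rw [← filter_eq', filter_add_not]
  refine ⟨k, s.count k, s.filter (¬ · = k), count_ne_zero.2 hks, hdec, hlt, ?_⟩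
  rw [← Finset.card_insert_of_notMem (a := k)
    (fun h => (hlt k (mem_toFinset.1 h)).false)]
  congr 1
  ext x
  by_cases hx : x = k
  · simp [hx, hks]
  · simp [hx]

lemma card_toFinset_replicate_add_le (c : ℕ) (k : ℝ) (t : Multiset ℝ) :
    (replicate c k + t).toFinset.card ≤ t.toFinset.card + 1 := by
  refine (Finset.card_le_card (t := insert k t.toFinset) fun x hx => ?_).trans
    (Finset.card_insert_le _ _)
  simp only [mem_toFinset, mem_add, mem_replicate] at hx
  simp only [Finset.mem_insert, mem_toFinset]
  tauto

lemma toFinset_map_neg_card (s : Multiset ℝ) :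
    (s.map Neg.neg).toFinset.card = s.toFinset.card := by
  rw [toFinset_map, Finset.card_image_of_injective _ neg_injective]

lemma exists_eq_replicate_add_of_min {s : Multiset ℝ} (hs : s ≠ 0) :
    ∃ (k : ℝ) (c : ℕ) (t : Multiset ℝ), c ≠ 0 ∧ s = replicate c k + t ∧ (∀ x ∈ t, k < x) ∧
      s.toFinset.card = t.toFinset.card + 1 := by
  obtain ⟨k, c, t, hc, h, hlt, hcard⟩ := exists_eq_replicate_add_of_max
    (s := s.map Neg.neg) (by simpa using hs)
  refine ⟨-k, c, t.map Neg.neg, hc, ?_, ?_, ?_⟩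
  · simpa using congrArg (Multiset.map Neg.neg) h
  · intro x hx
    obtain ⟨y, hy, rfl⟩ := mem_map.1 hx
    exact neg_lt_neg (hlt y hy)
  · rw [toFinset_map_neg_card, ← hcard, toFinset_map_neg_card]

/-- The rightmost reported location always obtains a facility. The proof is by induction on the
number of distinct locations: when the leftmost agents join another location, the location that is
then leftmost is served, by induction applied to the mirror image. Hence a facility stays to the
left of the two rightmost locations. -/
theorem places_max (hn : 4 ≤ n) : ∀ (N : ℕ) (M : NiceRule n) (s : Multiset ℝ), s.card = n →
    s.toFinset.card ≤ N → ∀ k ∈ s, (∀ x ∈ s, x ≤ k) → M.Places k s := by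
  intro N
  induction N with
  | zero =>
    intro M s hs hN k hk
    rw [Nat.le_zero, Finset.card_eq_zero] at hN
    exact absurd (mem_toFinset.2 hk) (by simp [hN])
  | succ N ih =>
    intro M s hs hN k hk hmax
    obtain ⟨k', c, s₁, hc, rfl, hlt₁, hcard₁⟩ := exists_eq_replicate_add_of_max (s := s)
      (by rintro rfl; simp at hk)
    obtain rfl : k = k' := by
      refine le_antisymm ?_ (hmax k' (by simp [mem_replicate, hc]))
      rcases mem_add.1 hk with h | h
      · exact (eq_of_mem_replicate h).le
      · exact (hlt₁ k h).le
    rcases eq_or_ne s₁ 0 with rfl | hs₁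
    · exact places_of_forall_eq_or_eq hs (y := k) (z := k) (fun x hx => by
        simp [mem_replicate] at hx; exact Or.inl hx.2) hk
    obtain ⟨j, b, s₂, hb, rfl, hlt₂, hcard₂⟩ := exists_eq_replicate_add_of_max hs₁
    rcases eq_or_ne s₂ 0 with rfl | hs₂
    · exact places_of_forall_eq_or_eq hs (y := k) (z := j) (fun x hx => by
        simp only [mem_add, mem_replicate, notMem_zero, or_false] at hx; tauto) hk
    have hjk : j < k := hlt₁ j (by simp [mem_replicate, hb])
    obtain ⟨y, d, s₃, hd, h₃, hlt₃, hcard₃⟩ := exists_eq_replicate_add_of_max hs₂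
    have hys₂ : y ∈ s₂ := by rw [h₃]; simp [mem_replicate, hd]
    have hyj : y < j := hlt₂ y hys₂
    have hle₂ : ∀ x ∈ s₂, x ≤ y := by
      intro x hx
      rw [h₃, mem_add] at hx
      exact hx.elim (fun h => (eq_of_mem_replicate h).le) fun h => (hlt₃ x h).le
    rcases eq_or_ne s₃ 0 with rfl | hs₃
    · rw [h₃, add_zero] at hs ⊢
      exact maxServed hn M b hd hb hc (by simpa [add_comm, add_left_comm] using hs) y j k hyj hjk
    obtain ⟨L, a, s₄, ha, h₄, hlt₄, hcard₄⟩ := exists_eq_replicate_add_of_min hs₂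
    have hLy : L < y := by
      obtain ⟨x, hx⟩ := exists_mem_of_ne_zero hs₃
      refine lt_of_le_of_lt ?_ (hlt₃ x hx)
      have : x ∈ s₂ := by rw [h₃]; exact mem_add.2 (Or.inr hx)
      rw [h₄, mem_add] at this
      exact this.elim (fun h => (eq_of_mem_replicate h).ge) fun h => (hlt₄ x h).le
    have hys₄ : y ∈ s₄ := by
      rw [h₄, mem_add] at hys₂
      exact hys₂.resolve_left fun h => hLy.ne' (eq_of_mem_replicate h)
    simp only [card_add, card_replicate] at hs
    have hs₂' : s₂.card = a + s₄.card := by rw [h₄, card_add, card_replicate]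
    refine places_right_of_forall_le (L := y) (by omega) hc ?_ ?_ hyj hjk
    · intro j k hyj hjk
      -- The agents at `L` join those at `y`.
      set t := replicate a y + (s₄ + (replicate c k + replicate b j)) with ht
      have htcard : t.card = n := by simp [ht]; omega
      obtain ⟨m, a', t', ha', htm, hltm, -⟩ := exists_eq_replicate_add_of_min (s := t) (by
        rintro h
        rw [h, card_zero] at htcard
        omega)
      have hmt : m ∈ t := by rw [htm]; simp [mem_replicate, ha']
      have hmin : ∀ x ∈ t, m ≤ x := by
        intro x hx
        rw [htm, mem_add] at hx
        exact hx.elim (fun h => (eq_of_mem_replicate h).ge) fun h => (hltm x h).le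
      have hmy : m ≤ y := hmin y (by simp [ht, mem_replicate, ha])
      have hLm : L < m := by
        simp only [ht, mem_add, mem_replicate] at hmt
        rcases hmt with ⟨-, rfl⟩ | h | ⟨-, rfl⟩ | ⟨-, rfl⟩
        · exact hLy
        · exact hlt₄ m h
        · linarith
        · linarith
      have hsub : t.toFinset.card ≤ N := by
        have h1 : t.toFinset.card ≤ (replicate c k + (replicate b j + s₄)).toFinset.card := by
          refine Finset.card_le_card fun x hx => ?_
          simp only [ht, mem_toFinset, mem_add, mem_replicate] at hx ⊢
          rcases hx with ⟨-, rfl⟩ | h | h | h <;> tauto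
        have h2 := card_toFinset_replicate_add_le c k (replicate b j + s₄)
        have h3 := card_toFinset_replicate_add_le b j s₄
        omega
      have hpm : M.Places m t := by
        have := ih M.reflect (t.map Neg.neg) (by simpa using htcard)
          (by rwa [toFinset_map_neg_card]) (-m) (mem_map_of_mem _ hmt) (by
            intro x hx
            obtain ⟨w, hw, rfl⟩ := mem_map.1 hx
            exact neg_le_neg (hmin w hw))
        rw [places_reflect, map_map] at this
        simpa using this
      obtain ⟨f, hf, hLf⟩ := exists_places_of_cost_le
        ((group_strategyproof' L (card_replicate a y) (by simp; omega)).trans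
          (cost_le_of_places hpm L))
      rw [abs_of_neg (by linarith : L - m < 0)] at hLf
      refine ⟨f, ?_, by linarith [(abs_le.1 hLf).1]⟩
      convert hf using 1
      rw [h₄]
      abel
    · intro j hyj
      refine ih M _ (by simp; omega) ?_ j (by simp [mem_replicate, hc]) fun x hx => ?_
      · rw [← add_assoc, ← replicate_add]
        have := card_toFinset_replicate_add_le (c + b) j s₂
        omega
      · simp only [mem_add, mem_replicate] at hx
        rcases hx with ⟨-, rfl⟩ | ⟨-, rfl⟩ | h
        · exact le_rfl
        · exact le_rfl
        · exact (hle₂ x h).trans hyj.le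

end NiceRule
end FacilityLocation

namespace FacilityLocation

open Multiset

variable {n : ℕ}

/-! ### Mechanisms as functions of multisets -/

lemma agentCost_two (a : ℝ) (y : Fin 2 → ℝ) :
    agentCost a y = min |a - y 0| |a - y 1| := by
  refine le_antisymm (le_min (ciInf_le (Set.finite_range _).bddBelow 0)
    (ciInf_le (Set.finite_range _).bddBelow 1)) (le_ciInf fun l => ?_)
  fin_cases l
  exacts [min_le_left _ _, min_le_right _ _]

lemma agentCost_nonneg {K : ℕ} (a : ℝ) (y : Fin K → ℝ) : 0 ≤ agentCost a y :=
  Real.iInf_nonneg fun _ => abs_nonneg _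

lemma socialCost_nonneg {K : ℕ} (x : Fin n → ℝ) (y : Fin K → ℝ) : 0 ≤ socialCost x y :=
  Finset.sum_nonneg fun _ _ => agentCost_nonneg _ _

lemma agentCost_le_socialCost {K : ℕ} (x : Fin n → ℝ) (y : Fin K → ℝ) (i : Fin n) :
    agentCost (x i) y ≤ socialCost x y :=
  Finset.single_le_sum (f := fun i => agentCost (x i) y) (fun _ _ => agentCost_nonneg _ _)
    (Finset.mem_univ i)

lemma optCost_le {K : ℕ} (x : Fin n → ℝ) (y : Fin K → ℝ) : optCost K x ≤ socialCost x y :=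
  ciInf_le ⟨0, by rintro _ ⟨y, rfl⟩; exact socialCost_nonneg x y⟩ y

/-- The multiset of reported locations of a profile. -/
def locations (x : Fin n → ℝ) : Multiset ℝ := Finset.univ.val.map x

/-- The profile in which the agents report the elements of `s` in increasing order. Missing elements
are replaced by `0` when `s` has fewer than `n` elements. -/
noncomputable def sortedProfile (n : ℕ) (s : Multiset ℝ) : Fin n → ℝ :=
  fun i => (s.sort (· ≤ ·)).getD i 0

lemma card_locations (x : Fin n → ℝ) : (locations x).card = n := by simp [locations]

lemma mem_locations {x : Fin n → ℝ} {a : ℝ} : a ∈ locations x ↔ ∃ i, x i = a := by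
  simp [locations]

lemma locations_eq_ofFn (x : Fin n → ℝ) : locations x = (List.ofFn x : Multiset ℝ) := by
  simp [locations, List.ofFn_eq_map, Fin.univ_def]

lemma locations_sortedProfile {s : Multiset ℝ} (hs : s.card = n) :
    locations (sortedProfile n s) = s := by
  subst hs
  rw [locations_eq_ofFn]
  conv_rhs => rw [← s.sort_eq (· ≤ ·)]
  congr 1
  refine List.ext_getElem (by simp) fun i h1 h2 => ?_
  rw [List.getElem_ofFn]
  exact List.getD_eq_getElem _ _ h2

lemma exists_sortedProfile_eq_comp (x : Fin n → ℝ) :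
    ∃ p : Equiv.Perm (Fin n), sortedProfile n (locations x) = x ∘ p := by
  refine ⟨Tuple.sort x, ?_⟩
  have h : (locations x).sort (· ≤ ·) = List.ofFn (x ∘ Tuple.sort x) := by
    refine List.Perm.eq_of_pairwise' (r := (· ≤ ·)) (pairwise_sort _ _)
      (Tuple.monotone_sort x).sortedLE_ofFn.pairwise ?_
    rw [← coe_eq_coe, sort_eq, locations_eq_ofFn]
    exact coe_eq_coe.2 (Equiv.Perm.ofFn_comp_perm _ _).symm
  funext i
  simp [sortedProfile, h]

lemma exists_locations_update {a : ℝ} {s : Multiset ℝ} (hs : 1 + s.card = n) (b : ℝ) :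
    ∃ (x : Fin n → ℝ) (i : Fin n), x i = a ∧ locations x = a ::ₘ s ∧
      locations (Function.update x i b) = b ::ₘ s := by
  have h := locations_sortedProfile (n := n) (s := a ::ₘ s) (by rw [card_cons]; omega)
  set x := sortedProfile n (a ::ₘ s)
  obtain ⟨i, hi⟩ := mem_locations.1 (h.symm ▸ mem_cons_self a s)
  have key : ∀ y : Fin n → ℝ, locations y = y i ::ₘ (Finset.univ.erase i).val.map y := by
    intro y
    rw [← map_cons, Finset.erase_val, cons_erase (Finset.mem_univ i)]
    rfl
  refine ⟨x, i, hi, h, ?_⟩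
  rw [key x, hi, cons_inj_right] at h
  rw [key, Function.update_self, ← h]
  congr 1
  refine map_congr rfl fun j hj => ?_
  rw [Function.update_of_ne (Finset.ne_of_mem_erase (Finset.mem_def.2 hj))]

lemma Mechanism.IsAnonymous.apply_sortedProfile {K : ℕ} {F : Mechanism K n} (hF : F.IsAnonymous)
    (x : Fin n → ℝ) : F (sortedProfile n (locations x)) = F x := by
  obtain ⟨p, hp⟩ := exists_sortedProfile_eq_comp x
  rw [hp, ← hF]

/-- The rule on multisets that underlies an anonymous mechanism: it is evaluated at the profile that
lists the multiset in increasing order. -/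
noncomputable def Mechanism.toNiceRule (F : Mechanism 2 n) (hF : F.IsAnonymous)
    (hsp : F.IsStrategyproof) {ρ : ℝ} (hρ : F.HasApproxRatio ρ) : NiceRule n where
  fst s := F (sortedProfile n s) 0
  snd s := F (sortedProfile n s) 1
  ratio := ρ
  strategyproof' a b s hs := by
    obtain ⟨x, i, rfl, hx, hy⟩ := exists_locations_update (a := a) hs b
    rw [← hx, ← hy, hF.apply_sortedProfile, hF.apply_sortedProfile, ← agentCost_two,
      ← agentCost_two]
    exact hsp x i b
  approx' s hs a ha y z := by
    have hx := locations_sortedProfile hs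
    set x := sortedProfile n s
    rw [← hx] at ha
    obtain ⟨i, rfl⟩ := mem_locations.1 ha
    rw [← agentCost_two]
    refine (agentCost_le_socialCost x (F x) i).trans ((hρ.2 x).trans
      (mul_le_mul_of_nonneg_left ((optCost_le x ![y, z]).trans_eq ?_) (zero_le_one.trans hρ.1)))
    rw [← hx, locations, map_map]
    simp only [socialCost, agentCost_two]
    rfl
  one_le_ratio := hρ.1

lemma Mechanism.places_toNiceRule {F : Mechanism 2 n} {hF : F.IsAnonymous}
    {hsp : F.IsStrategyproof} {ρ : ℝ} {hρ : F.HasApproxRatio ρ} {a : ℝ} {x : Fin n → ℝ} :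
    (F.toNiceRule hF hsp hρ).Places a (locations x) ↔ a = F x 0 ∨ a = F x 1 := by
  simp only [NiceRule.Places, toNiceRule, hF.apply_sortedProfile]

/-! ### The Two-Extremes mechanism -/

lemma iInf_le_apply (x : Fin n → ℝ) (i : Fin n) : ⨅ j, x j ≤ x i :=
  ciInf_le (Set.finite_range _).bddBelow i

lemma apply_le_iSup (x : Fin n → ℝ) (i : Fin n) : x i ≤ ⨆ j, x j :=
  le_ciSup (Set.finite_range _).bddAbove i

lemma iInf_lt_iSup {x : Fin n → ℝ} {i j : Fin n} (h : x i ≠ x j) : ⨅ k, x k < ⨆ k, x k := by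
  rcases h.lt_or_gt with h | h
  · exact (iInf_le_apply x i).trans_lt (h.trans_le (apply_le_iSup x j))
  · exact (iInf_le_apply x j).trans_lt (h.trans_le (apply_le_iSup x i))

lemma agentCost_le_abs {K : ℕ} (a : ℝ) (y : Fin K → ℝ) (l : Fin K) :
    agentCost a y ≤ |a - y l| :=
  ciInf_le (Set.finite_range _).bddBelow l

/-- Two of any three agents share a facility, and their costs add up to at least their distance. -/
lemma min_sub_le_socialCost {x : Fin n → ℝ} (y : Fin 2 → ℝ) {i j k : Fin n} (hij : x i ≤ x j)
    (hjk : x j ≤ x k) : min (x j - x i) (x k - x j) ≤ socialCost x y := by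
  rcases hij.eq_or_lt with hij | hij
  · exact (min_le_left _ _).trans (by rw [hij, sub_self]; exact socialCost_nonneg x y)
  rcases hjk.eq_or_lt with hjk | hjk
  · exact (min_le_right _ _).trans (by rw [hjk, sub_self]; exact socialCost_nonneg x y)
  have h : ∑ l ∈ {i, j, k}, agentCost (x l) y ≤ socialCost x y :=
    Finset.sum_le_sum_of_subset_of_nonneg (Finset.subset_univ _)
      fun _ _ _ => agentCost_nonneg _ _
  have hij' : i ≠ j := by rintro rfl; exact hij.false
  have hjk' : j ≠ k := by rintro rfl; exact hjk.false
  have hik' : i ≠ k := by rintro rfl; exact (hij.trans hjk).false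
  rw [Finset.sum_insert (by simp [hij', hik']), Finset.sum_pair hjk'] at h
  refine le_trans ?_ h
  simp only [agentCost_two]
  grind

lemma isStrategyproof_of_extremes {F : Mechanism 2 n}
    (h : ∀ x : Fin n → ℝ, (∃ i j, x i ≠ x j) → F x = ![⨅ i, x i, ⨆ i, x i])
    (h' : ∀ c : ℝ, ∃ l, F (fun _ => c) l = c) : F.IsStrategyproof := by
  intro x i y
  have : Nonempty (Fin n) := ⟨i⟩
  have of_served : ∀ l, F x l = x i →
      agentCost (x i) (F x) ≤ agentCost (x i) (F (Function.update x i y)) := fun l hl =>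
    ((agentCost_le_abs (x i) (F x) l).trans (by rw [hl, sub_self, abs_zero])).trans
      (agentCost_nonneg _ _)
  by_cases hx : ∃ j k, x j ≠ x k
  · obtain ⟨j, hj⟩ := exists_eq_ciInf_of_finite (f := x)
    obtain ⟨k, hk⟩ := exists_eq_ciSup_of_finite (f := x)
    have hFx := h x hx
    rcases eq_or_ne j i with rfl | hji
    · exact of_served 0 (by simp [hFx, hj])
    rcases eq_or_ne k i with rfl | hki
    · exact of_served 1 (by simp [hFx, hk])
    have hjk : x j < x k := by
      obtain ⟨a, b, hab⟩ := hx
      rw [hj, hk]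
      exact iInf_lt_iSup hab
    -- The extremes are attained by other agents, so a misreport can only push them outwards.
    set x' := Function.update x i y with hx'
    have hj' : x' j = x j := Function.update_of_ne hji _ _
    have hk' : x' k = x k := Function.update_of_ne hki _ _
    have hFx' := h x' ⟨j, k, by rw [hj', hk']; exact hjk.ne⟩
    have h1 := iInf_le_apply x' j
    have h2 := apply_le_iSup x' k
    have h3 := iInf_le_apply x i
    have h4 := apply_le_iSup x i
    rw [hj', hj] at h1
    rw [hk', hk] at h2
    rw [agentCost_two, agentCost_two, hFx, hFx']
    simp only [Matrix.cons_val_zero, Matrix.cons_val_one]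
    refine min_le_min ?_ ?_
    · rw [abs_of_nonneg (by linarith), abs_of_nonneg (by linarith)]; linarith
    · rw [abs_of_nonpos (by linarith), abs_of_nonpos (by linarith)]; linarith
  · push Not at hx
    obtain ⟨l, hl⟩ := h' (x i)
    exact of_served l (by rwa [show x = fun _ => x i from funext fun j => hx j i])

lemma hasApproxRatio_of_extremes (hn : n ≠ 0) {F : Mechanism 2 n}
    (h : ∀ x : Fin n → ℝ, (∃ i j, x i ≠ x j) → F x = ![⨅ i, x i, ⨆ i, x i])
    (h' : ∀ c : ℝ, ∃ l, F (fun _ => c) l = c) : F.HasApproxRatio n := by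
  refine ⟨by exact_mod_cast Nat.one_le_iff_ne_zero.2 hn, fun x => ?_⟩
  have : Nonempty (Fin n) := Fin.pos_iff_nonempty.1 (Nat.pos_of_ne_zero hn)
  have key : ∀ i, agentCost (x i) (F x) ≤ optCost 2 x := by
    intro i
    refine le_ciInf fun y => ?_
    by_cases hx : ∃ j k, x j ≠ x k
    · obtain ⟨j, hj⟩ := exists_eq_ciInf_of_finite (f := x)
      obtain ⟨k, hk⟩ := exists_eq_ciSup_of_finite (f := x)
      have h3 : x j ≤ x i := hj ▸ iInf_le_apply x i
      have h4 : x i ≤ x k := hk ▸ apply_le_iSup x i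
      refine le_trans ?_ (min_sub_le_socialCost y h3 h4)
      rw [agentCost_two, h x hx]
      simp only [Matrix.cons_val_zero, Matrix.cons_val_one]
      rw [← hj, ← hk, abs_of_nonneg (by linarith), abs_of_nonpos (by linarith), neg_sub]
    · push Not at hx
      obtain ⟨l, hl⟩ := h' (x i)
      refine (agentCost_le_abs _ _ l).trans ?_
      rw [show F x l = x i by rwa [show x = fun _ => x i from funext fun j => hx j i], sub_self,
        abs_zero]
      exact socialCost_nonneg x y
  refine (Finset.sum_le_card_nsmul Finset.univ _ _ fun i _ => key i).trans ?_
  simp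

lemma extremes_of_isStrategyproof (hn : 4 ≤ n) {F : Mechanism 2 n} (hF : F.IsAnonymous)
    (hsp : F.IsStrategyproof) {ρ : ℝ} (hρ : F.HasApproxRatio ρ) {x : Fin n → ℝ}
    (hx : ∃ i j, x i ≠ x j) : F x = ![⨅ i, x i, ⨆ i, x i] := by
  obtain ⟨a, b, hab⟩ := hx
  have : Nonempty (Fin n) := ⟨a⟩
  have hlt := iInf_lt_iSup hab
  obtain ⟨j, hj⟩ := exists_eq_ciInf_of_finite (f := x)
  obtain ⟨k, hk⟩ := exists_eq_ciSup_of_finite (f := x)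
  have hmax : ⨆ i, x i = F x 0 ∨ ⨆ i, x i = F x 1 := by
    refine (F.places_toNiceRule (hF := hF) (hsp := hsp) (hρ := hρ)).1
      (NiceRule.places_max hn _ _ _ (card_locations x) le_rfl _ (mem_locations.2 ⟨k, hk⟩) ?_)
    rintro _ hy
    obtain ⟨i, rfl⟩ := mem_locations.1 hy
    exact apply_le_iSup x i
  have hmin : ⨅ i, x i = F x 0 ∨ ⨅ i, x i = F x 1 := by
    refine (F.places_toNiceRule (hF := hF) (hsp := hsp) (hρ := hρ)).1 ?_
    have h := NiceRule.places_max hn _ (F.toNiceRule hF hsp hρ).reflect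
      ((locations x).map Neg.neg) (by rw [card_map, card_locations]) le_rfl (-⨅ i, x i)
      (mem_map_of_mem _ (mem_locations.2 ⟨j, hj⟩)) (by
        intro y hy
        obtain ⟨w, hw, rfl⟩ := mem_map.1 hy
        obtain ⟨i, rfl⟩ := mem_locations.1 hw
        exact neg_le_neg (iInf_le_apply x i))
    rw [NiceRule.places_reflect, map_map] at h
    simpa using h
  have h01 : F x 0 ≤ F x 1 := F.monotone_toFun x (by decide)
  have : F x 0 = ⨅ i, x i ∧ F x 1 = ⨆ i, x i := by
    rcases hmin with h | h <;> rcases hmax with h' | h' <;> constructor <;> linarith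
  funext l
  fin_cases l
  exacts [this.1, this.2]

end FacilityLocation

theorem mainTheorem2 (n : ℕ) (hn : 5 ≤ n) (F : FacilityLocation.Mechanism 2 n)
    (hF : F.IsAnonymous) :
    (F.IsStrategyproof ∧ F.HasBoundedApproxRatio) ↔
      ((∀ x : Fin n → ℝ, (∃ i j, x i ≠ x j) → F x = ![⨅ i, x i, ⨆ i, x i]) ∧
        (∀ c : ℝ, ∃ l, F (fun _ => c) l = c)) := by
  open FacilityLocation in
  constructor
  · rintro ⟨hsp, ρ, hρ⟩
    refine ⟨fun x hx => extremes_of_isStrategyproof (by omega) hF hsp hρ hx, fun c => ?_⟩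
    have h := (F.toNiceRule hF hsp hρ).places_of_forall_eq_or_eq
      (card_locations fun _ : Fin n => c) (y := c) (z := c) (a := c) (fun y hy => by
        obtain ⟨_, rfl⟩ := mem_locations.1 hy
        exact Or.inl rfl) (mem_locations.2 ⟨⟨0, by omega⟩, rfl⟩)
    rcases F.places_toNiceRule.1 h with h | h
    exacts [⟨0, h.symm⟩, ⟨1, h.symm⟩]
  · rintro ⟨h, h'⟩
    exact ⟨isStrategyproof_of_extremes h h', n, hasApproxRatio_of_extremes (by omega) h h'⟩
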